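/- Let $(A_n)_{n\ge 1}$ be unital $C^*$-algebras with unital $*$-homomorphisms $\phi_n:A_n\to A_{n+1}$, let $A=\varinjlim(A_n,\phi_n)$ be the $C^*$-inductive limit and $\phi^n:A_n\to A$ the canonical unital $*$-homomorphisms. Write $\mathcal S(B)$ for the state space of a unital $C^*$-algebra $B$. A Lip-norm on $B$ is a seminorm $L:B\to[0,\infty]$ (with $0\cdot\infty=0$) such that $L(b^*)=L(b)$ for all $b\in B$; $L(b)=0$ if and only if $b\in\mathbb C\mathbf 1_B$; $\mathrm{dom}(L)=\{b:L(b)<\infty\}$ is dense in $B$; and the topology on $\mathcal S(B)$ of the metric $$\rho_L(\mu,\nu)=\sup\{|\mu(b)-\nu(b)|: b\in B,\ L(b)\le 1\}$$ is the weak$^*$-topology. Let $(L_n)$ and $(L_n')$ be two sequences such that $L_n$ and $L_n'$ are Lip-norms on $A_n$ with $\phi_n(\mathrm{dom}(L_n))\subset\mathrm{dom}(L_{n+1})$ and $\phi_n(\mathrm{dom}(L_n'))\subset\mathrm{dom}(L_{n+1}')$ for all $n$. Define on $A$ $$L(a)=\sup\left\{\frac{|\mu(a)-\nu(a)|}{\rho(\mu,\nu)}:\mu,\nu\in\mathcal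 S(A),\ \mu\ne\nu\right\},\qquad \rho(\mu,\nu)=\sum_{n=1}^\infty\frac1{2^n}\,\frac{\rho_{L_n}(\mu\circ\phi^n,\nu\circ\phi^n)}{1+\rho_{L_n}(\mu\circ\phi^n,\nu\circ\phi^n)},$$ and define $L'$ in the same way from $(L_n')$. Suppose that there are bounded sequences $(\gamma_n)$ and $(\lambda_n)$ of nonnegative real numbers such that $$L'(\phi^n(a))\le\gamma_nL_n(a)\quad\text{and}\quad L(\phi^n(a))\le\lambda_nL_n'(a)\qquad\text{for all } n\ge 1 \text{ and } a\in A_n.$$ Then, for all $a\in A$, $$\frac{1}{2\sup_n\gamma_n}\,L'(a)\le L(a)\le 2\sup_n\lambda_n\,L'(a),$$ where $1/0=\infty$ and $0\cdot\infty=0$. -/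

import Mathlib

open scoped ENNReal NNReal ComplexOrder Topology
open Filter UniformSpace

universe u

noncomputable section

/-! ### Inductive limits of sequences of unital C*-algebras -/

namespace CStarInd

section Limit

variable {A : ℕ → Type u} [∀ n, CStarAlgebra (A n)] (φ : ∀ n, A n →⋆ₐ[ℂ] A (n + 1))

/-- The *-algebra of all sequences `(x₀, x₁, …)` with `xₙ ∈ Aₙ` which satisfy
`xₙ₊₁ = φₙ(xₙ)` for all large `n`. -/
def coherent : StarSubalgebra ℂ (∀ n, A n) where
  carrier := {x | ∀ᶠ n in atTop, x (n + 1) = φ n (x n)}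
  mul_mem' hx hy := by
    filter_upwards [hx, hy] with n h₁ h₂
    simp [h₁, h₂]
  one_mem' := by simp
  add_mem' hx hy := by
    filter_upwards [hx, hy] with n h₁ h₂
    simp [h₁, h₂]
  zero_mem' := by simp
  algebraMap_mem' r := by
    refine Eventually.of_forall fun n => ?_
    simp only [Pi.algebraMap_apply]
    exact (AlgHomClass.commutes (φ n) r).symm
  star_mem' hx := by
    filter_upwards [hx] with n h
    simp [h, map_star]

/-- A copy of `coherent φ` that carries the seminorm `‖x‖ = limₙ ‖xₙ‖` in place of the
topology of the product. -/
def PreLimit : Type u := ↥(coherent φ)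

instance : Ring (PreLimit φ) := inferInstanceAs (Ring ↥(coherent φ))
instance : StarRing (PreLimit φ) := inferInstanceAs (StarRing ↥(coherent φ))
instance : Algebra ℂ (PreLimit φ) := inferInstanceAs (Algebra ℂ ↥(coherent φ))
instance : StarModule ℂ (PreLimit φ) := inferInstanceAs (StarModule ℂ ↥(coherent φ))

variable {φ}

/-- The `n`-th entry of a sequence. -/
def PreLimit.entry (x : PreLimit φ) (n : ℕ) : A n := x.1 n

namespace PreLimit

lemma ext_entry {x y : PreLimit φ} (h : ∀ n, x.entry n = y.entry n) : x = y :=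
  Subtype.ext (funext h)

@[simp] lemma entry_add (x y : PreLimit φ) (n : ℕ) : (x + y).entry n = x.entry n + y.entry n := rfl
@[simp] lemma entry_mul (x y : PreLimit φ) (n : ℕ) : (x * y).entry n = x.entry n * y.entry n := rfl
@[simp] lemma entry_neg (x : PreLimit φ) (n : ℕ) : (-x).entry n = -x.entry n := rfl
@[simp] lemma entry_sub (x y : PreLimit φ) (n : ℕ) : (x - y).entry n = x.entry n - y.entry n := rfl
@[simp] lemma entry_zero (n : ℕ) : (0 : PreLimit φ).entry n = 0 := rfl
@[simp] lemma entry_one (n : ℕ) : (1 : PreLimit φ).entry n = 1 := rfl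
@[simp] lemma entry_star (x : PreLimit φ) (n : ℕ) : (star x).entry n = star (x.entry n) := rfl
@[simp] lemma entry_smul (c : ℂ) (x : PreLimit φ) (n : ℕ) :
    (c • x).entry n = c • x.entry n := rfl

/-- The seminorm: along a sequence in `PreLimit φ` the norms eventually decrease, so the upper
limit is a limit. -/
instance : Norm (PreLimit φ) := ⟨fun x => limsup (fun n => ‖x.entry n‖) atTop⟩

lemma tendsto_norm (x : PreLimit φ) :
    Tendsto (fun n => ‖x.entry n‖) atTop (𝓝 ‖x‖) := by
  obtain ⟨N, hN⟩ := eventually_atTop.1 x.2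
  have anti : Antitone fun k => ‖x.entry (k + N)‖ := by
    refine antitone_nat_of_succ_le fun k => ?_
    have e : ‖x.entry (k + 1 + N)‖ = ‖x.entry (k + N + 1)‖ := by
      rw [Nat.add_right_comm k 1 N]
    have e' : x.entry (k + N + 1) = φ (k + N) (x.entry (k + N)) := hN _ (by omega)
    rw [e, e']
    exact NonUnitalStarAlgHom.norm_apply_le (φ (k + N)) _
  have lim := tendsto_atTop_ciInf anti ⟨0, by rintro _ ⟨k, rfl⟩; exact norm_nonneg _⟩
  have lim' := (tendsto_add_atTop_iff_nat (f := fun n => ‖x.entry n‖) N).1 lim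
  have : ‖x‖ = _ := lim'.limsup_eq
  rwa [this]

instance : SeminormedAddCommGroup (PreLimit φ) :=
  AddGroupSeminorm.toSeminormedAddCommGroup
    { toFun := fun x => ‖x‖
      map_zero' := tendsto_nhds_unique (tendsto_norm (0 : PreLimit φ)) (by simp)
      add_le' := fun x y => le_of_tendsto_of_tendsto' (tendsto_norm (x + y))
        ((tendsto_norm x).add (tendsto_norm y)) fun n => norm_add_le _ _
      neg' := fun x => tendsto_nhds_unique (tendsto_norm (-x)) (by simpa using tendsto_norm x) }

instance : SeminormedRing (PreLimit φ) where
  __ := (inferInstance : SeminormedAddCommGroup (PreLimit φ))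
  __ := (inferInstance : Ring (PreLimit φ))
  norm_mul_le x y := le_of_tendsto_of_tendsto' (tendsto_norm (x * y))
    ((tendsto_norm x).mul (tendsto_norm y)) fun _ => norm_mul_le _ _

instance : NormedAlgebra ℂ (PreLimit φ) where
  norm_smul_le c x := le_of_tendsto_of_tendsto' (tendsto_norm (c • x))
    ((tendsto_norm x).const_mul ‖c‖) fun _ => by simp [norm_smul]

instance : NormedStarGroup (PreLimit φ) where
  norm_star_le x := le_of_tendsto_of_tendsto' (tendsto_norm (star x)) (tendsto_norm x)
    fun _ => by simp

lemma norm_mul_self_le (x : PreLimit φ) : ‖x‖ * ‖x‖ ≤ ‖star x * x‖ :=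
  le_of_tendsto_of_tendsto' ((tendsto_norm x).mul (tendsto_norm x)) (tendsto_norm (star x * x))
    fun _ => by simp [CStarRing.norm_star_mul_self]

end PreLimit

variable (φ)

/-- The inductive limit `A = lim (Aₙ, φₙ)`: the C*-algebra obtained from the eventually coherent
sequences, with the seminorm `limₙ ‖xₙ‖`, by separation and completion. -/
abbrev InductiveLimit : Type u := Completion (PreLimit φ)

namespace InductiveLimit

/-- The involution is the continuous extension of the entrywise involution. -/
instance : Star (InductiveLimit φ) :=
  ⟨(Completion.map star : Completion (PreLimit φ) → Completion (PreLimit φ))⟩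

variable {φ}

/-- The class of an eventually coherent sequence in the inductive limit. -/
def mk (x : PreLimit φ) : InductiveLimit φ := (x : Completion (PreLimit φ))

lemma induction {p : InductiveLimit φ → Prop} (x : InductiveLimit φ) (hc : IsClosed {x | p x})
    (h : ∀ x : PreLimit φ, p (mk x)) : p x :=
  Completion.induction_on (p := p) x hc h

lemma mk_add (x y : PreLimit φ) : mk (x + y) = mk x + mk y := Completion.coe_add x y
lemma mk_mul (x y : PreLimit φ) : mk (x * y) = mk x * mk y := Completion.coe_mul x y
lemma mk_smul (c : ℂ) (x : PreLimit φ) : mk (c • x) = c • mk x := Completion.coe_smul c x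
lemma mk_one : mk (1 : PreLimit φ) = 1 := Completion.coe_one _
lemma mk_zero : mk (0 : PreLimit φ) = 0 := Completion.coe_zero
lemma norm_mk (x : PreLimit φ) : ‖mk x‖ = ‖x‖ := Completion.norm_coe x
lemma mk_star (x : PreLimit φ) : mk (star x) = star (mk x) :=
  (Completion.map_coe (uniformContinuous_of_continuousAt_zero
    (starAddEquiv : PreLimit φ ≃+ PreLimit φ) continuous_star.continuousAt) x).symm

lemma cont_star : Continuous (fun x : InductiveLimit φ => star x) :=
  Completion.continuous_map

instance : CStarAlgebra (InductiveLimit φ) where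
  norm_smul_le := norm_smul_le
  star_involutive x := by
    refine induction (p := fun x => star (star x) = x) x
      (isClosed_eq (cont_star.comp cont_star) continuous_id) fun x => ?_
    rw [← mk_star, ← mk_star, star_star]
  star_mul x y := by
    refine induction (p := fun x => star (x * y) = star y * star x) x
      (isClosed_eq (cont_star.comp (continuous_id.mul continuous_const))
        (continuous_const.mul cont_star)) fun x => ?_
    refine induction (p := fun y => star (mk x * y) = star y * star (mk x)) y
      (isClosed_eq (cont_star.comp (continuous_const.mul continuous_id))
        (cont_star.mul continuous_const)) fun y => ?_
    rw [← mk_star, ← mk_star, ← mk_mul, ← mk_mul, ← mk_star, star_mul]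
  star_add x y := by
    refine induction (p := fun x => star (x + y) = star x + star y) x
      (isClosed_eq (cont_star.comp (continuous_id.add continuous_const))
        (cont_star.add continuous_const)) fun x => ?_
    refine induction (p := fun y => star (mk x + y) = star (mk x) + star y) y
      (isClosed_eq (cont_star.comp (continuous_const.add continuous_id))
        (continuous_const.add cont_star)) fun y => ?_
    rw [← mk_star, ← mk_star, ← mk_add, ← mk_add, ← mk_star, star_add]
  norm_mul_self_le x := by
    refine induction (p := fun x => ‖x‖ * ‖x‖ ≤ ‖star x * x‖) x
      (isClosed_le (continuous_norm.mul continuous_norm)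
        (continuous_norm.comp (cont_star.mul continuous_id))) fun x => ?_
    rw [← mk_star, ← mk_mul, norm_mk, norm_mk]
    exact x.norm_mul_self_le
  star_smul c x := by
    refine induction (p := fun x => star (c • x) = star c • star x) x
      (isClosed_eq (cont_star.comp (continuous_const_smul c))
        (cont_star.const_smul (star c))) fun x => ?_
    rw [← mk_star, ← mk_smul, ← mk_smul, ← mk_star, star_smul]

end InductiveLimit

/-- The connecting map `φₖ₋₁ ∘ ⋯ ∘ φₙ : Aₙ → Aₖ` for `n ≤ k`. -/
def connecting {n k : ℕ} (h : n ≤ k) : A n →⋆ₐ[ℂ] A k :=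
  Nat.leRec (motive := fun k _ => A n →⋆ₐ[ℂ] A k) (StarAlgHom.id ℂ (A n))
    (fun k _ f => (φ k).comp f) h

lemma connecting_succ {n k : ℕ} (h : n ≤ k) (a : A n) :
    connecting φ (h.trans k.le_succ) a = φ k (connecting φ h a) := by
  unfold connecting
  rw [Nat.leRec_succ (h1 := h)]
  rfl

/-- For `a ∈ Aₙ`, the sequence with entries `0` before `n` and `φₖ₋₁ ⋯ φₙ (a)` at `k ≥ n`. -/
def preToLimit (n : ℕ) (a : A n) : PreLimit φ :=
  ⟨fun k => if h : n ≤ k then connecting φ h a else 0, by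
    refine eventually_atTop.2 ⟨n, fun k hk => ?_⟩
    simp only [hk, hk.trans k.le_succ, dif_pos]
    exact connecting_succ φ hk a⟩

variable {φ} in
lemma InductiveLimit.mk_eq_of_eventually {x y : PreLimit φ}
    (h : ∀ᶠ n in atTop, x.entry n = y.entry n) :
    InductiveLimit.mk x = InductiveLimit.mk y := by
  have h0 : ‖x - y‖ = 0 := tendsto_nhds_unique (PreLimit.tendsto_norm (x - y))
    (tendsto_const_nhds.congr' (by filter_upwards [h] with n hn; simp [hn]))
  have h1 : ‖InductiveLimit.mk x - InductiveLimit.mk y‖ = 0 := by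
    rw [← h0, ← InductiveLimit.norm_mk]
    exact congrArg norm (Completion.coe_sub x y).symm
  exact sub_eq_zero.1 (norm_eq_zero.1 h1)

lemma entry_preToLimit {n k : ℕ} (h : n ≤ k) (a : A n) :
    (preToLimit φ n a).entry k = connecting φ h a := dif_pos h

/-- The canonical unital *-homomorphism `φⁿ : Aₙ → A` into the inductive limit. -/
def toLimit (n : ℕ) : A n →⋆ₐ[ℂ] InductiveLimit φ where
  toFun a := InductiveLimit.mk (preToLimit φ n a)
  map_one' := by
    rw [← InductiveLimit.mk_one]
    refine InductiveLimit.mk_eq_of_eventually (eventually_atTop.2 ⟨n, fun k hk => ?_⟩)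
    simp [entry_preToLimit φ hk]
  map_zero' := by
    rw [← InductiveLimit.mk_zero]
    refine InductiveLimit.mk_eq_of_eventually (eventually_atTop.2 ⟨n, fun k hk => ?_⟩)
    simp [entry_preToLimit φ hk]
  map_mul' a b := by
    rw [← InductiveLimit.mk_mul]
    refine InductiveLimit.mk_eq_of_eventually (eventually_atTop.2 ⟨n, fun k hk => ?_⟩)
    simp [entry_preToLimit φ hk]
  map_add' a b := by
    rw [← InductiveLimit.mk_add]
    refine InductiveLimit.mk_eq_of_eventually (eventually_atTop.2 ⟨n, fun k hk => ?_⟩)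
    simp [entry_preToLimit φ hk]
  commutes' c := by
    rw [Algebra.algebraMap_eq_smul_one, Algebra.algebraMap_eq_smul_one,
      ← InductiveLimit.mk_one, ← InductiveLimit.mk_smul]
    refine InductiveLimit.mk_eq_of_eventually (eventually_atTop.2 ⟨n, fun k hk => ?_⟩)
    simp [entry_preToLimit φ hk]
  map_star' a := by
    rw [← InductiveLimit.mk_star]
    refine InductiveLimit.mk_eq_of_eventually (eventually_atTop.2 ⟨n, fun k hk => ?_⟩)
    simp [entry_preToLimit φ hk, map_star]

end Limit

/-! ### States, Lip-norms and the seminorm on the limit -/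

section States

variable {A B : Type u} [CStarAlgebra A] [CStarAlgebra B]

/-- The state space of a unital C*-algebra, as a subset of the dual with the weak* topology. -/
def stateSpace (A : Type u) [CStarAlgebra A] : Set (WeakDual ℂ A) :=
  {μ | μ 1 = 1 ∧ ∀ a : A, 0 ≤ μ (star a * a)}

/-- The map `μ ↦ μ ∘ ψ` on states induced by a unital *-homomorphism `ψ`. -/
def pullback (ψ : A →⋆ₐ[ℂ] B) (μ : stateSpace B) : stateSpace A :=
  ⟨((StrongDual.toWeakDual ((WeakDual.toStrongDual μ.1).comp
      (⟨(ψ : A →ₐ[ℂ] B).toLinearMap, 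
        AddMonoidHomClass.continuous_of_bound ψ 1 fun a => by
          simpa using NonUnitalStarAlgHom.norm_apply_le ψ a⟩ : A →L[ℂ] B)))), by
    refine ⟨?_, fun a => ?_⟩
    · change μ.1 (ψ 1) = 1
      rw [map_one]
      exact μ.2.1
    · change 0 ≤ μ.1 (ψ (star a * a))
      rw [map_mul, map_star]
      exact μ.2.2 (ψ a)⟩

/-- The (extended) Monge-Kantorovich metric
`ρ_L(μ, ν) = sup {|μ(a) - ν(a)| : a ∈ A, L(a) ≤ 1}` on the state space. -/
def mkDist (L : A → ℝ≥0∞) (μ ν : stateSpace A) : ℝ≥0∞ :=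
  ⨆ (a : A) (_ : L a ≤ 1), ‖μ.1 a - ν.1 a‖ₑ

/-- `L` is a Lip-norm on the unital C*-algebra `A`; the value `∞` is allowed. -/
structure IsLipNorm (L : A → ℝ≥0∞) : Prop where
  add_le : ∀ a b, L (a + b) ≤ L a + L b
  smul : ∀ (c : ℂ) (a : A), L (c • a) = ‖c‖ₑ * L a
  star : ∀ a, L (star a) = L a
  eq_zero_iff : ∀ a, L a = 0 ↔ ∃ c : ℂ, a = algebraMap ℂ A c
  dense_dom : Dense {a | L a < ∞}
  /-- The open sets of the metric `ρ_L` are the weak* open sets of states. -/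
  isOpen_iff : ∀ U : Set (stateSpace A),
    IsOpen U ↔ ∀ μ ∈ U, ∃ ε : ℝ≥0∞, 0 < ε ∧ ∀ ν, mkDist L μ ν < ε → ν ∈ U

end States

section LimitSeminorm

variable {A : ℕ → Type u} [∀ n, CStarAlgebra (A n)] (φ : ∀ n, A n →⋆ₐ[ℂ] A (n + 1))

/-- `((Aₙ, Lₙ), φₙ)` is an inductive sequence of compact quantum metric spaces. -/
structure IsInductiveSequence (L : ∀ n, A n → ℝ≥0∞) : Prop where
  isLipNorm : ∀ n, IsLipNorm (L n)
  map_dom : ∀ n (a : A n), L n a < ∞ → L (n + 1) (φ n a) < ∞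

/-- The metric `ρ(μ, ν) = ∑ₙ 2⁻ⁿ ρₙ / (1 + ρₙ)`, `ρₙ = ρ_{Lₙ}(μ ∘ φⁿ, ν ∘ φⁿ)`, on the states of
the inductive limit. The first algebra has index `0` here, so its weight is `2^(-(0 + 1))`. -/
def limitDist (L : ∀ n, A n → ℝ≥0∞) (μ ν : stateSpace (InductiveLimit φ)) : ℝ≥0∞ :=
  ∑' n : ℕ, (2 ^ (n + 1))⁻¹ *
    (mkDist (L n) (pullback (toLimit φ n) μ) (pullback (toLimit φ n) ν) /
      (1 + mkDist (L n) (pullback (toLimit φ n) μ) (pullback (toLimit φ n) ν)))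

/-- The seminorm `L(a) = sup {|μ(a) - ν(a)| / ρ(μ, ν) : μ ≠ ν}` induced on the inductive limit. -/
def limitSeminorm (L : ∀ n, A n → ℝ≥0∞) (a : InductiveLimit φ) : ℝ≥0∞ :=
  ⨆ (μ : stateSpace (InductiveLimit φ)) (ν : stateSpace (InductiveLimit φ)) (_ : μ ≠ ν),
    ‖μ.1 a - ν.1 a‖ₑ / limitDist φ L μ ν

end LimitSeminorm

end CStarInd

end

namespace CStarInd

/-! A bound `L (φⁿ a) ≤ c * L'ₙ a` on the seminorms dualizes to the bound `ρ' ≤ c * ρ` on the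
metrics. If `L'ₙ a ≤ 1`, then `|μ (φⁿ a) - ν (φⁿ a)| ≤ L (φⁿ a) * ρ(μ, ν) ≤ c * ρ(μ, ν)`, so every
`ρ_{L'ₙ}` is at most `c * ρ`. As `d / (1 + d) ≤ d` and the weights sum to `1`, the same bound holds
for `ρ'` (`limitDist_le_mul`). Dividing by the metrics turns it back into `L ≤ c * L'` on the whole
limit (`limitSeminorm_le_mul`).

Both inequalities are instances of this, with the supremum of the given sequence as `c`. The factor
`2` is slack. -/

lemma div_one_add_le_self (d : ℝ≥0∞) : d / (1 + d) ≤ d :=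
  ENNReal.div_le_of_le_mul (le_mul_of_one_le_right' le_self_add)

lemma div_one_add_le_one (d : ℝ≥0∞) : d / (1 + d) ≤ 1 :=
  ENNReal.div_le_of_le_mul (by simp)

lemma tsum_weight : ∑' n : ℕ, ((2 : ℝ≥0∞) ^ (n + 1))⁻¹ = 1 := by
  simpa [ENNReal.inv_pow, ENNReal.inv_mul_cancel] using ENNReal.tsum_geometric_add_one 2⁻¹

lemma tsum_weight_mul_le {f : ℕ → ℝ≥0∞} {c : ℝ≥0∞} (h : ∀ n, f n ≤ c) :
    ∑' n : ℕ, ((2 : ℝ≥0∞) ^ (n + 1))⁻¹ * f n ≤ c :=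
  calc ∑' n : ℕ, ((2 : ℝ≥0∞) ^ (n + 1))⁻¹ * f n
      ≤ ∑' n : ℕ, ((2 : ℝ≥0∞) ^ (n + 1))⁻¹ * c :=
        ENNReal.tsum_le_tsum fun n => mul_le_mul_right (h n) _
    _ = c := by rw [ENNReal.tsum_mul_right, tsum_weight, one_mul]

variable {A : ℕ → Type u} [∀ n, CStarAlgebra (A n)] (φ : ∀ n, A n →⋆ₐ[ℂ] A (n + 1))

/-- From some `N` on, the sequence is generated by its `N`-th entry, and the seminorm sees only the
tail. Hence the images of the `Aₙ` fill the dense image of `PreLimit φ`. -/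
lemma mk_mem_range_toLimit (x : PreLimit φ) :
    ∃ (n : ℕ) (a : A n), toLimit φ n a = InductiveLimit.mk x := by
  obtain ⟨N, hN⟩ := eventually_atTop.1 x.2
  refine ⟨N, x.entry N, InductiveLimit.mk_eq_of_eventually (eventually_atTop.2 ⟨N, fun k hk => ?_⟩)⟩
  rw [entry_preToLimit φ hk]
  induction k, hk using Nat.le_induction with
  | base => simp [connecting]
  | succ k hk ih =>
    rw [connecting_succ φ hk, ih]
    exact (hN k hk).symm

/-- States of the inductive limit are determined by their restrictions to the `Aₙ`. -/
lemma state_ext {μ ν : stateSpace (InductiveLimit φ)}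
    (h : ∀ n (a : A n), μ.1 (toLimit φ n a) = ν.1 (toLimit φ n a)) : μ = ν := by
  refine Subtype.ext (DFunLike.ext _ _ fun x => ?_)
  refine InductiveLimit.induction (p := fun x => μ.1 x = ν.1 x) x
    (isClosed_eq (map_continuous μ.1) (map_continuous ν.1)) fun x => ?_
  obtain ⟨n, a, ha⟩ := mk_mem_range_toLimit φ x
  rw [← ha]
  exact h n a

lemma limitDist_le_one (L : ∀ n, A n → ℝ≥0∞) (μ ν : stateSpace (InductiveLimit φ)) :
    limitDist φ L μ ν ≤ 1 :=
  tsum_weight_mul_le fun _ => div_one_add_le_one _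

lemma div_le_limitSeminorm (L : ∀ n, A n → ℝ≥0∞) {μ ν : stateSpace (InductiveLimit φ)}
    (hne : μ ≠ ν) (x : InductiveLimit φ) :
    ‖μ.1 x - ν.1 x‖ₑ / limitDist φ L μ ν ≤ limitSeminorm φ L x := by
  unfold limitSeminorm
  refine le_iSup_of_le μ (le_iSup_of_le ν ?_)
  exact le_iSup (fun _ : μ ≠ ν => ‖μ.1 x - ν.1 x‖ₑ / limitDist φ L μ ν) hne

lemma enorm_sub_le_limitSeminorm_mul (L : ∀ n, A n → ℝ≥0∞)
    {μ ν : stateSpace (InductiveLimit φ)} (hne : μ ≠ ν) {x : InductiveLimit φ}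
    (hx : limitSeminorm φ L x ≠ ∞) :
    ‖μ.1 x - ν.1 x‖ₑ ≤ limitSeminorm φ L x * limitDist φ L μ ν :=
  -- Finiteness of the seminorm handles a vanishing distance: it excludes the value `t / 0 = ∞` for
  -- `t ≠ 0`.
  (ENNReal.div_le_iff_le_mul (.inr hx)
    (.inl (ne_top_of_le_ne_top ENNReal.one_ne_top (limitDist_le_one φ L μ ν)))).1
    (div_le_limitSeminorm φ L hne x)

variable {φ} in
-- The bound holds for each `ρ_{L'ₙ}` separately, and `ρ'` is dominated by their weighted average.
lemma limitDist_le_mul {L L' : ∀ n, A n → ℝ≥0∞} {c : ℝ≥0}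
    (h : ∀ n (a : A n), limitSeminorm φ L (toLimit φ n a) ≤ c * L' n a)
    {μ ν : stateSpace (InductiveLimit φ)} (hne : μ ≠ ν) :
    limitDist φ L' μ ν ≤ c * limitDist φ L μ ν := by
  refine tsum_weight_mul_le fun n => (div_one_add_le_self _).trans (iSup₂_le fun a ha => ?_)
  have hc : limitSeminorm φ L (toLimit φ n a) ≤ c :=
    (h n a).trans (by simpa using mul_le_mul_right ha (c : ℝ≥0∞))
  exact (enorm_sub_le_limitSeminorm_mul φ L hne (ne_top_of_le_ne_top ENNReal.coe_ne_top hc)).trans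
    (mul_le_mul_left hc _)

variable {φ} in
/-- The comparison of two limit seminorms, with the constant `c` in place of `2c`. -/
lemma limitSeminorm_le_mul {L L' : ∀ n, A n → ℝ≥0∞} {c : ℝ≥0}
    (h : ∀ n (a : A n), limitSeminorm φ L (toLimit φ n a) ≤ c * L' n a)
    (x : InductiveLimit φ) :
    limitSeminorm φ L x ≤ c * limitSeminorm φ L' x := by
  refine iSup_le fun μ => iSup_le fun ν => iSup_le fun hne => ?_
  rcases eq_or_ne c 0 with rfl | hc
  -- If `c = 0`, then `L` vanishes on the image of every `Aₙ`, so distinct states cannot exist.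
  · refine absurd (state_ext φ fun n a => ?_) hne
    have h0 : limitSeminorm φ L (toLimit φ n a) = 0 := by simpa using h n a
    have := enorm_sub_le_limitSeminorm_mul φ L hne (x := toLimit φ n a) (by simp [h0])
    simpa [h0, sub_eq_zero] using this
  have hc' : (c : ℝ≥0∞) ≠ 0 := by simpa using hc
  calc ‖μ.1 x - ν.1 x‖ₑ / limitDist φ L μ ν
      = c * (‖μ.1 x - ν.1 x‖ₑ / (c * limitDist φ L μ ν)) := by
        rw [← mul_div_assoc, ENNReal.mul_div_mul_left _ _ hc' ENNReal.coe_ne_top]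
    _ ≤ c * (‖μ.1 x - ν.1 x‖ₑ / limitDist φ L' μ ν) :=
        mul_le_mul_right (ENNReal.div_le_div_left (limitDist_le_mul h hne) _) _
    _ ≤ c * limitSeminorm φ L' x :=
        mul_le_mul_right (div_le_limitSeminorm φ L' hne x) _

/-- Boundedness is essential: in `ℝ≥0` the supremum of an unbounded family defaults to `0`. -/
lemma mul_le_iSup_mul {γ : ℕ → ℝ≥0} (hγ : BddAbove (Set.range γ)) (n : ℕ) (t : ℝ≥0∞) :
    (γ n : ℝ≥0∞) * t ≤ ((⨆ n, γ n : ℝ≥0) : ℝ≥0∞) * t :=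
  mul_le_mul_left (ENNReal.coe_le_coe.2 (le_ciSup hγ n)) t

lemma one_div_two_mul_mul_le {c : ℝ≥0} {s t : ℝ≥0∞} (h : s ≤ c * t) :
    1 / (2 * (c : ℝ≥0∞)) * s ≤ t := by
  rcases eq_or_ne c 0 with rfl | hc
  -- Here the prefactor is `1 / 0 = ∞`, but `s = 0` and `∞ * 0 = 0`.
  · have : s = 0 := by simpa using h
    simp [this]
  rw [one_div]
  refine (ENNReal.inv_mul_le_iff (by simpa using hc) (by finiteness)).2 (h.trans ?_)
  exact mul_le_mul_left (le_mul_of_one_le_left' one_le_two) t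

end CStarInd

theorem corollary4p4 {A : ℕ → Type u} [∀ n, CStarAlgebra (A n)]
    (φ : ∀ n, A n →⋆ₐ[ℂ] A (n + 1)) (L L' : ∀ n, A n → ℝ≥0∞)
    (hL : CStarInd.IsInductiveSequence φ L) (hL' : CStarInd.IsInductiveSequence φ L')
    (γ lam : ℕ → ℝ≥0) (hγ : BddAbove (Set.range γ)) (hlam : BddAbove (Set.range lam))
    (h₁ : ∀ n (a : A n),
      CStarInd.limitSeminorm φ L' (CStarInd.toLimit φ n a) ≤ (γ n : ℝ≥0∞) * L n a)
    (h₂ : ∀ n (a : A n),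
      CStarInd.limitSeminorm φ L (CStarInd.toLimit φ n a) ≤ (lam n : ℝ≥0∞) * L' n a)
    (a : CStarInd.InductiveLimit φ) :
    1 / (2 * ((⨆ n, γ n : ℝ≥0) : ℝ≥0∞)) * CStarInd.limitSeminorm φ L' a
        ≤ CStarInd.limitSeminorm φ L a ∧
      CStarInd.limitSeminorm φ L a
        ≤ 2 * ((⨆ n, lam n : ℝ≥0) : ℝ≥0∞) * CStarInd.limitSeminorm φ L' a := by
  have h₁' := CStarInd.limitSeminorm_le_mul
    (fun n a => (h₁ n a).trans (CStarInd.mul_le_iSup_mul hγ n _)) a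
  have h₂' := CStarInd.limitSeminorm_le_mul
    (fun n a => (h₂ n a).trans (CStarInd.mul_le_iSup_mul hlam n _)) a
  exact ⟨CStarInd.one_div_two_mul_mul_le h₁',
    h₂'.trans (mul_le_mul_left (le_mul_of_one_le_left' one_le_two) _)⟩
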